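/- Let $k$ be a field and let $H$ be a finite-dimensional Hopf algebra over $k$ with comultiplication $\Delta$ and counit $\varepsilon$. Assume that $H$ is unimodular, i.e. there is a nonzero $t \in H$ with $ht = \varepsilon(h)t = th$ for all $h \in H$. For $n \ge 0$ let $\Delta^n : H \to H^{\otimes(n+1)}$ be the iterated comultiplication ($\Delta^0 = \mathrm{id}_H$, $\Delta^{n+1} = (\Delta^n \otimes \mathrm{id}_H)\circ\Delta$), an algebra homomorphism into the tensor power algebra. Then for every $n \ge 0$, $\Delta^n$ is injective and is an (ordinary, untwisted) Frobenius extension. Here a ring homomorphism $f : B \to A$ is called a Frobenius extension if there are a $B$-$B$-bimodule homomorphism $E : A \to B$ ($A$ being a $B$-$B$-bimodule through $f$) and finitely many elements $x_1,\dots,x_m, y_1,\dots,y_m \in A$ such that $\sum_i x_i\, f(E(y_i a)) = a = \sum_i f(E(a x_i))\, y_i$ for all $a \in A$. -/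

import Mathlib

open scoped TensorProduct

/-- The ring homomorphism `f : B → A` is a (nontwisted) Frobenius extension: there is a
`B`-`B`-bimodule homomorphism `E : A → B` (a Frobenius homomorphism) together with finite dual
bases `x i`, `y i` in `A`, meaning that `∑ x i * E (y i * a) = a = ∑ E (a * x i) * y i` for all
`a`. Here `A` is a `B`-`B`-bimodule through `f`. -/
def IsFrobeniusExtension {B A : Type*} [Ring B] [Ring A] (f : B →+* A) : Prop :=
  ∃ (E : A →+ B) (m : ℕ) (x y : Fin m → A),
    (∀ (b : B) (a : A), E (f b * a) = b * E a) ∧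
    (∀ (a : A) (b : B), E (a * f b) = E a * b) ∧
    (∀ a : A, ∑ i, x i * f (E (y i * a)) = a) ∧
    (∀ a : A, ∑ i, f (E (a * x i)) * y i = a)

/-- A Hopf algebra is unimodular if it has a nonzero two-sided integral. -/
def IsUnimodular (k H : Type*) [Field k] [Ring H] [HopfAlgebra k H] : Prop :=
  ∃ t : H, t ≠ 0 ∧
    (∀ h : H, h * t = Coalgebra.counit (R := k) h • t) ∧
    (∀ h : H, t * h = Coalgebra.counit (R := k) h • t)

section TensorPowers

variable (k H : Type*) [Field k] [Ring H] [Algebra k H]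

/-- The canonical linear isomorphism `H^{⊗(n+1)} ⊗ H ≃ H^{⊗(n+2)}`. -/
noncomputable def tensorSnocLinear (n : ℕ) :
    ((⨂[k] _ : Fin (n + 1), H) ⊗[k] H) ≃ₗ[k] (⨂[k] _ : Fin (n + 2), H) :=
  (TensorProduct.congr (LinearEquiv.refl k _)
      (PiTensorProduct.subsingletonEquiv (R := k) (s := fun _ : Fin 1 => H) 0).symm) ≪≫ₗ
    PiTensorProduct.tmulEquiv k H ≪≫ₗ
    PiTensorProduct.reindex k (fun _ => H) finSumFinEquiv

theorem tensorSnocLinear_tmul (n : ℕ) (x : Fin (n + 1) → H) (h : H) :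
    tensorSnocLinear k H n (PiTensorProduct.tprod k x ⊗ₜ[k] h) =
      PiTensorProduct.tprod k (Fin.snoc x h : Fin (n + 2) → H) := by
  have e : (PiTensorProduct.subsingletonEquiv (R := k) (s := fun _ : Fin 1 => H) 0).symm h =
      PiTensorProduct.tprod k (fun _ => h) :=
    PiTensorProduct.subsingletonEquiv_symm_apply' 0 h
  rw [tensorSnocLinear, LinearEquiv.trans_apply, LinearEquiv.trans_apply,
    TensorProduct.congr_tmul, LinearEquiv.refl_apply, e, PiTensorProduct.tmulEquiv_apply]
  refine (PiTensorProduct.reindex_tprod (R := k) (s := fun _ => H) finSumFinEquiv _).trans ?_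
  congr 1
  funext i
  refine Fin.lastCases ?_ (fun j => ?_) i
  · have : finSumFinEquiv.symm (Fin.last (n + 1)) = Sum.inr (0 : Fin 1) := by
      rw [Equiv.symm_apply_eq]; rfl
    simp [this]
  · have : finSumFinEquiv.symm (Fin.castSucc j : Fin (n + 1 + 1)) = Sum.inl j := by
      rw [Equiv.symm_apply_eq]; rfl
    simp [this]

/-- The canonical algebra isomorphism `H^{⊗(n+1)} ⊗ H ≃ H^{⊗(n+2)}`, sending
`(x₀ ⊗ ⋯ ⊗ xₙ) ⊗ h` to `x₀ ⊗ ⋯ ⊗ xₙ ⊗ h`; tensor powers carry the factorwise product. -/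
noncomputable def tensorSnoc (n : ℕ) :
    ((⨂[k] _ : Fin (n + 1), H) ⊗[k] H) ≃ₐ[k] (⨂[k] _ : Fin (n + 2), H) :=
  Algebra.TensorProduct.algEquivOfLinearEquivTensorProduct (tensorSnocLinear k H n)
    (by
      intro a₁ a₂ b₁ b₂
      induction a₁ using PiTensorProduct.induction_on with
      | add p q hp hq =>
        simp only [add_mul, TensorProduct.add_tmul, map_add, hp, hq]
      | smul_tprod r p =>
        induction a₂ using PiTensorProduct.induction_on with
        | add p q hp hq =>
          simp only [mul_add, TensorProduct.add_tmul, map_add, hp, hq]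
        | smul_tprod s q =>
          simp only [smul_mul_smul_comm, PiTensorProduct.tprod_mul_tprod,
            ← TensorProduct.smul_tmul', map_smul, tensorSnocLinear_tmul]
          congr 2
          funext i
          refine Fin.lastCases ?_ (fun j => ?_) i <;> simp)
    (by
      rw [PiTensorProduct.one_def, tensorSnocLinear_tmul, PiTensorProduct.one_def]
      congr 1
      funext i
      refine Fin.lastCases ?_ (fun j => ?_) i <;> simp)

theorem tensorSnoc_tmul (n : ℕ) (x : Fin (n + 1) → H) (h : H) :
    tensorSnoc k H n (PiTensorProduct.tprod k x ⊗ₜ[k] h) =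
      PiTensorProduct.tprod k (Fin.snoc x h : Fin (n + 2) → H) :=
  tensorSnocLinear_tmul k H n x h

end TensorPowers

/-- The iterated comultiplication `Δⁿ : H → H^{⊗(n+1)}` as a homomorphism of algebras:
`Δ⁰` is the canonical identification of `H` with `H^{⊗1}`, and `Δⁿ⁺¹ = (Δⁿ ⊗ id) ∘ Δ`. -/
noncomputable def iterComul (k H : Type*) [Field k] [Ring H] [HopfAlgebra k H] :
    (n : ℕ) → H →ₐ[k] (⨂[k] _ : Fin (n + 1), H)
  | 0 => PiTensorProduct.singleAlgHom (R := k) (A := fun _ : Fin 1 => H) 0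
  | n + 1 => ((tensorSnoc k H n).toAlgHom.comp
      (Algebra.TensorProduct.map (iterComul k H n) (AlgHom.id k H))).comp
        (Bialgebra.comulAlgHom k H)

/-! Frobenius extensions are closed under isomorphism, composition and tensoring with an algebra, so
the recursion for `iterComul` reduces everything to `Δ`. Injectivity follows the same recursion,
from the counit and flatness over a field. For `Δ`, the integral `t` makes `f ↦ t₁ f(t₂)` a
bijection from the dual of `H` to `H` (`dualToSelf_bijective`). The preimage `φ` of `1` is a
Frobenius functional; two-sidedness of `t` makes its Nakayama automorphism exactly `S²`
(`exists_frobenius_functional`). Then `E(a ⊗ b) = φ(a S(b₁)) b₂` is right `H`-linear for every `φ`,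
and left linear because `S²` absorbs the twist. If `e i`, `d i` are dual bases for `φ`, then `e i ⊗
1`, `d i ⊗ 1` are dual bases for `E`. -/

/-! ### Closure properties of Frobenius extensions -/

namespace IsFrobeniusExtension

/-- The dual bases of a Frobenius extension may be indexed by any finite type. -/
theorem of_fintype {B A ι : Type*} [Ring B] [Ring A] [Fintype ι] {f : B →+* A} (E : A →+ B)
    (x y : ι → A) (hl : ∀ (b : B) (a : A), E (f b * a) = b * E a)
    (hr : ∀ (a : A) (b : B), E (a * f b) = E a * b)
    (hx : ∀ a : A, ∑ i, x i * f (E (y i * a)) = a)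
    (hy : ∀ a : A, ∑ i, f (E (a * x i)) * y i = a) : IsFrobeniusExtension f := by
  let e := Fintype.equivFin ι
  refine ⟨E, Fintype.card ι, x ∘ e.symm, y ∘ e.symm, hl, hr, fun a => ?_, fun a => ?_⟩
  · exact (e.symm.sum_comp (fun i => x i * f (E (y i * a)))).trans (hx a)
  · exact (e.symm.sum_comp (fun i => f (E (a * x i)) * y i)).trans (hy a)

/-- A ring isomorphism is a Frobenius extension. -/
theorem of_ringEquiv {B A : Type*} [Ring B] [Ring A] (e : B ≃+* A) :
    IsFrobeniusExtension (e : B →+* A) :=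
  of_fintype (ι := Unit) (e.symm : A →+ B) 1 1 (by simp) (by simp) (by simp) (by simp)

/-- Frobenius extensions compose. -/
theorem comp {B A C : Type*} [Ring B] [Ring A] [Ring C] {g : A →+* C} {f : B →+* A}
    (hg : IsFrobeniusExtension g) (hf : IsFrobeniusExtension f) :
    IsFrobeniusExtension (g.comp f) := by
  obtain ⟨E, m, x, y, hl, hr, hx, hy⟩ := hf
  obtain ⟨E', m', x', y', hl', hr', hx', hy'⟩ := hg
  refine of_fintype (ι := Fin m' × Fin m) (E.comp E') (fun i => x' i.1 * g (x i.2))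
    (fun i => g (y i.2) * y' i.1) (fun b a => by simp [hl, hl']) (fun b a => by simp [hr, hr'])
    (fun a => ?_) (fun a => ?_)
  · simp only [Fintype.sum_prod_type, RingHom.comp_apply, AddMonoidHom.comp_apply, mul_assoc, hl',
      ← map_mul, ← Finset.mul_sum, ← map_sum, hx, hx']
  · simp only [Fintype.sum_prod_type, RingHom.comp_apply, AddMonoidHom.comp_apply, ← mul_assoc, hr',
      ← map_mul, ← Finset.sum_mul, ← map_sum, hy, hy']

/-- Tensoring a Frobenius extension of algebras with an algebra gives a Frobenius extension. -/
theorem tensorProduct_map_id {k B A : Type*} (C : Type*) [CommRing k] [Ring B] [Ring A] [Ring C]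
    [Algebra k B] [Algebra k A] [Algebra k C] {f : B →ₐ[k] A}
    (hf : IsFrobeniusExtension (f : B →+* A)) :
    IsFrobeniusExtension
      (Algebra.TensorProduct.map f (AlgHom.id k C) : B ⊗[k] C →+* A ⊗[k] C) := by
  obtain ⟨E, m, x, y, hl, hr, hx, hy⟩ := hf
  simp only [RingHom.coe_coe] at hl hr hx hy
  -- `E` is `k`-linear because `f` fixes scalars, so it can be tensored with `C`.
  let E' : A →ₗ[k] B :=
    { E with
      map_smul' := fun r a => by
        have := hl (algebraMap k B r) a
        rwa [AlgHom.commutes, ← Algebra.smul_def, ← Algebra.smul_def] at this }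
  have hE : ∀ a, E' a = E a := fun _ => rfl
  refine of_fintype (E'.rTensor C).toAddMonoidHom (fun i => x i ⊗ₜ 1) (fun i => y i ⊗ₜ 1)
    (fun b a => ?_) (fun a b => ?_) (fun a => ?_) (fun a => ?_)
  · induction b with
    | zero => simp
    | add p q hp hq => simp only [map_add, add_mul, hp, hq]
    | tmul b c =>
      induction a with
      | zero => simp
      | add p q hp hq => simp only [map_add, mul_add, hp, hq]
      | tmul a d => simp [hE, hl]
  · induction b with
    | zero => simp
    | add p q hp hq => simp only [map_add, mul_add, hp, hq]
    | tmul b c =>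
      induction a with
      | zero => simp
      | add p q hp hq => simp only [map_add, add_mul, hp, hq]
      | tmul a d => simp [hE, hr]
  · induction a with
    | zero => simp
    | add p q hp hq => simp only [map_add, mul_add, Finset.sum_add_distrib, hp, hq]
    | tmul a c => simp [hE, ← TensorProduct.sum_tmul, hx]
  · induction a with
    | zero => simp
    | add p q hp hq => simp only [map_add, add_mul, Finset.sum_add_distrib, hp, hq]
    | tmul a c => simp [hE, ← TensorProduct.sum_tmul, hy]

end IsFrobeniusExtension

/-! ### Reduction from the iterated comultiplication to `Δ` -/

theorem singleAlgHom_bijective (k H : Type*) [Field k] [Ring H] [Algebra k H] :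
    Function.Bijective (PiTensorProduct.singleAlgHom (R := k) (A := fun _ : Fin 1 => H) 0) := by
  have : ⇑(PiTensorProduct.singleAlgHom (R := k) (A := fun _ : Fin 1 => H) 0) =
      (PiTensorProduct.subsingletonEquiv (R := k) (s := fun _ : Fin 1 => H) 0).symm := by
    funext h
    refine Eq.trans ?_ (PiTensorProduct.subsingletonEquiv_symm_apply' 0 h).symm
    rw [PiTensorProduct.singleAlgHom_apply]
    congr 1
    funext i
    rw [Subsingleton.elim i 0]
    simp
  rw [this]
  exact LinearEquiv.bijective _

/-- The comultiplication of a Hopf algebra is injective. -/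
theorem comul_injective (k H : Type*) [Field k] [Ring H] [HopfAlgebra k H] :
    Function.Injective (Bialgebra.comulAlgHom k H) := by
  refine Function.LeftInverse.injective
    (g := fun z => TensorProduct.lid k H ((Coalgebra.counit (R := k) (A := H)).rTensor H z)) ?_
  intro h
  simp

theorem iterComul_injective (k H : Type*) [Field k] [Ring H] [HopfAlgebra k H] (n : ℕ) :
    Function.Injective (iterComul k H n) := by
  induction n with
  | zero => exact (singleAlgHom_bijective k H).1
  | succ n ih =>
    have h : Function.Injective (Algebra.TensorProduct.map (iterComul k H n) (AlgHom.id k H)) :=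
      Module.Flat.rTensor_preserves_injective_linearMap (M := H) (iterComul k H n).toLinearMap ih
    exact ((tensorSnoc k H n).injective.comp h).comp (comul_injective k H)

theorem iterComul_isFrobeniusExtension (k H : Type*) [Field k] [Ring H] [HopfAlgebra k H]
    (hΔ : IsFrobeniusExtension (Bialgebra.comulAlgHom k H : H →+* H ⊗[k] H)) (n : ℕ) :
    IsFrobeniusExtension (iterComul k H n : H →+* (⨂[k] _ : Fin (n + 1), H)) := by
  induction n with
  | zero =>
    exact IsFrobeniusExtension.of_ringEquiv
      (AlgEquiv.ofBijective _ (singleAlgHom_bijective k H)).toRingEquiv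
  | succ n ih =>
    exact ((IsFrobeniusExtension.of_ringEquiv (tensorSnoc k H n).toRingEquiv).comp
      (ih.tensorProduct_map_id H)).comp hΔ

/-! ### Sweedler identities and integrals -/

namespace HopfAlgebra

open Coalgebra

variable {k H : Type*} [CommRing k] [Ring H] [HopfAlgebra k H]

/-- If `m (h₁ ⊗ h₂) = ε(h)`, then `m (h₁ ⊗ h₂) ⊗ h₃ = 1 ⊗ h`. -/
theorem sum_rTensor_assoc_symm_comul (m : H ⊗[k] H →ₗ[k] H)
    (hm : ∀ h : H, m (comul h) = algebraMap k H (counit h)) (h : H) :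
    ∑ i ∈ (ℛ k h).index, m.rTensor H ((TensorProduct.assoc k H H H).symm
      ((ℛ k h).left i ⊗ₜ comul ((ℛ k h).right i))) = 1 ⊗ₜ h := by
  have hm' : m ∘ₗ comul = Algebra.linearMap k H ∘ₗ counit := LinearMap.ext hm
  have h1 := coassoc_symm_apply (R := k) h
  conv_lhs at h1 => rw [← (ℛ k h).eq]
  simp only [map_sum, LinearMap.lTensor_tmul] at h1
  rw [← map_sum, h1, ← LinearMap.comp_apply, ← LinearMap.rTensor_comp, hm',
    LinearMap.rTensor_comp, LinearMap.comp_apply, rTensor_counit_comul]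
  simp

/-- If `m (h₁ ⊗ h₂) = ε(h)`, then `h₁ ⊗ m (h₂ ⊗ h₃) = h ⊗ 1`. -/
theorem sum_lTensor_assoc_comul (m : H ⊗[k] H →ₗ[k] H)
    (hm : ∀ h : H, m (comul h) = algebraMap k H (counit h)) (h : H) :
    ∑ i ∈ (ℛ k h).index, m.lTensor H (TensorProduct.assoc k H H H
      (comul ((ℛ k h).left i) ⊗ₜ (ℛ k h).right i)) = h ⊗ₜ 1 := by
  have hm' : m ∘ₗ comul = Algebra.linearMap k H ∘ₗ counit := LinearMap.ext hm
  have h1 := coassoc_apply (R := k) h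
  conv_lhs at h1 => rw [← (ℛ k h).eq]
  simp only [map_sum, LinearMap.rTensor_tmul] at h1
  rw [← map_sum, h1, ← LinearMap.comp_apply, ← LinearMap.lTensor_comp, hm',
    LinearMap.lTensor_comp, LinearMap.comp_apply, lTensor_counit_comul]
  simp

/-- `S(h₁) h₂ ⊗ h₃ = 1 ⊗ h`. -/
theorem sum_antipode_tmul_one_mul_comul (h : H) :
    ∑ i ∈ (ℛ k h).index, (antipode k ((ℛ k h).left i) ⊗ₜ[k] (1 : H)) * comul ((ℛ k h).right i) =
      1 ⊗ₜ h := by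
  rw [← sum_rTensor_assoc_symm_comul (LinearMap.mul' k H ∘ₗ (antipode k).rTensor H)
    (fun h => by simp) h]
  refine Finset.sum_congr rfl fun i _ => ?_
  induction comul (R := k) ((ℛ k h).right i) with
  | zero => simp
  | add p q hp hq => simp only [mul_add, TensorProduct.tmul_add, map_add, hp, hq]
  | tmul a b => simp

/-- `h₁ S(h₂) ⊗ h₃ = 1 ⊗ h`. -/
theorem sum_mul_antipode_rTensor_comul (h : H) :
    ∑ i ∈ (ℛ k h).index, ((ℛ k h).left i ⊗ₜ[k] (1 : H)) *
      (antipode k).rTensor H (comul ((ℛ k h).right i)) = 1 ⊗ₜ h := by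
  rw [← sum_rTensor_assoc_symm_comul (LinearMap.mul' k H ∘ₗ (antipode k).lTensor H)
    (fun h => by simp) h]
  refine Finset.sum_congr rfl fun i _ => ?_
  induction comul (R := k) ((ℛ k h).right i) with
  | zero => simp
  | add p q hp hq => simp only [mul_add, TensorProduct.tmul_add, map_add, hp, hq]
  | tmul a b => simp

/-- `h₁ ⊗ h₂ S(h₃) = h ⊗ 1`. -/
theorem sum_comul_mul_one_tmul_antipode (h : H) :
    ∑ i ∈ (ℛ k h).index, comul ((ℛ k h).left i) * ((1 : H) ⊗ₜ[k] antipode k ((ℛ k h).right i)) =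
      h ⊗ₜ 1 := by
  rw [← sum_lTensor_assoc_comul (LinearMap.mul' k H ∘ₗ (antipode k).lTensor H)
    (fun h => by simp) h]
  refine Finset.sum_congr rfl fun i _ => ?_
  induction comul (R := k) ((ℛ k h).left i) with
  | zero => simp
  | add p q hp hq => simp only [add_mul, TensorProduct.add_tmul, map_add, hp, hq]
  | tmul a b => simp

/-- If `σ` is inverse to the antipode, then `h₂ σ(h₁) ⊗ h₃ = 1 ⊗ h`. -/
theorem sum_comul_mul_antipode_inv_tmul_one {σ : H →ₗ[k] H} (hσ : ∀ h, antipode k (σ h) = h)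
    (hS : Function.Injective (antipode k (A := H))) (h : H) :
    ∑ i ∈ (ℛ k h).index, comul ((ℛ k h).right i) * (σ ((ℛ k h).left i) ⊗ₜ[k] (1 : H)) =
      1 ⊗ₜ h := by
  rw [← sum_rTensor_assoc_symm_comul
    (LinearMap.mul' k H ∘ₗ (TensorProduct.comm k H H).toLinearMap ∘ₗ σ.rTensor H)
    (fun h => hS ?_) h]
  · refine Finset.sum_congr rfl fun i _ => ?_
    induction comul (R := k) ((ℛ k h).right i) with
    | zero => simp
    | add p q hp hq => simp only [add_mul, TensorProduct.tmul_add, map_add, hp, hq]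
    | tmul a b => simp
  -- Applying `S` turns `h₂ σ(h₁)` into `h₁ S(h₂) = ε(h)`.
  · have h1 := sum_mul_antipode_eq_smul (ℛ k h)
    rw [← (ℛ k h).eq]
    simp only [map_sum, LinearMap.comp_apply, LinearMap.rTensor_tmul, LinearEquiv.coe_coe,
      TensorProduct.comm_tmul, LinearMap.mul'_apply, antipode_mul_antidistrib, hσ, h1]
    simp [Algebra.algebraMap_eq_smul_one]

/-- A left integral `t` satisfies `t₁ ⊗ h t₂ = S(h) t₁ ⊗ t₂`. -/
theorem one_tmul_mul_comul_of_left_integral {t : H}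
    (ht : ∀ h : H, h * t = counit (R := k) h • t) (h : H) :
    ((1 : H) ⊗ₜ[k] h) * comul t = (antipode k h ⊗ₜ[k] (1 : H)) * comul t := by
  have h1 : ∑ i ∈ (ℛ k h).index, counit (R := k) ((ℛ k h).right i) • (ℛ k h).left i = h := by
    simpa only [map_sum, TensorProduct.rid_tmul, one_smul] using
      congr(TensorProduct.rid k H $(sum_tmul_counit_eq (R := k) (ℛ k h)))
  -- `S(h₁) h₂ t₁ ⊗ h₃ t₂` collapses, since `Δ(h₂)Δ(t) = Δ(h₂ t) = ε(h₂)Δ(t)`.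
  rw [← sum_antipode_tmul_one_mul_comul h, Finset.sum_mul]
  simp only [mul_assoc, ← Bialgebra.comul_mul, ht, map_smul, mul_smul_comm, ← smul_mul_assoc]
  simp only [TensorProduct.smul_tmul', ← map_smul]
  rw [← Finset.sum_mul, ← TensorProduct.sum_tmul, ← map_sum, h1]

/-- A right integral `t` satisfies `t₁ h ⊗ t₂ = t₁ ⊗ t₂ S(h)`. -/
theorem comul_mul_tmul_one_of_right_integral {t : H}
    (ht : ∀ h : H, t * h = counit (R := k) h • t) (h : H) :
    comul t * (h ⊗ₜ[k] (1 : H)) = comul t * ((1 : H) ⊗ₜ[k] antipode k h) := by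
  rw [← sum_comul_mul_one_tmul_antipode h, Finset.mul_sum]
  simp only [← mul_assoc, ← Bialgebra.comul_mul, ht, map_smul, smul_mul_assoc, ← mul_smul_comm]
  simp only [← TensorProduct.tmul_smul, ← map_smul]
  rw [← Finset.mul_sum, ← TensorProduct.tmul_sum, ← map_sum, sum_counit_smul]

section Integral

variable {k H : Type*} [CommRing k] [Ring H] [HopfAlgebra k H]

/-- The map `f ↦ t₁ f(t₂)` from functionals on `H` to `H`. -/
noncomputable def dualToSelf (t : H) : Module.Dual k H →ₗ[k] H where
  toFun f := TensorProduct.rid k H (f.lTensor H (comul t))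
  map_add' f g := by simp [LinearMap.lTensor_add]
  map_smul' r f := by simp [LinearMap.lTensor_smul]

theorem dualToSelf_apply (t : H) (f : Module.Dual k H) :
    dualToSelf t f = TensorProduct.rid k H (f.lTensor H (comul t)) := rfl

theorem rid_lTensor_mul_tmul_one (f : Module.Dual k H) (z : H ⊗[k] H) (h : H) :
    TensorProduct.rid k H (f.lTensor H (z * (h ⊗ₜ 1))) =
      TensorProduct.rid k H (f.lTensor H z) * h := by
  induction z with
  | zero => simp
  | add p q hp hq => simp only [add_mul, map_add, hp, hq]
  | tmul a b => simp

theorem rid_lTensor_tmul_one_mul (f : Module.Dual k H) (z : H ⊗[k] H) (h : H) :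
    TensorProduct.rid k H (f.lTensor H ((h ⊗ₜ 1) * z)) =
      h * TensorProduct.rid k H (f.lTensor H z) := by
  induction z with
  | zero => simp
  | add p q hp hq => simp only [mul_add, map_add, hp, hq]
  | tmul a b => simp

theorem lTensor_comp_mulRight (f : Module.Dual k H) (z : H ⊗[k] H) (h : H) :
    (f ∘ₗ LinearMap.mulRight k h).lTensor H z = f.lTensor H (z * (1 ⊗ₜ h)) := by
  induction z with
  | zero => simp
  | add p q hp hq => simp only [add_mul, map_add, hp, hq]
  | tmul a b => simp

theorem lTensor_comp_mulLeft (f : Module.Dual k H) (z : H ⊗[k] H) (h : H) :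
    (f ∘ₗ LinearMap.mulLeft k h).lTensor H z = f.lTensor H ((1 ⊗ₜ h) * z) := by
  induction z with
  | zero => simp
  | add p q hp hq => simp only [mul_add, map_add, hp, hq]
  | tmul a b => simp

/-- Makes the range of `dualToSelf t` a right ideal. -/
theorem dualToSelf_comp_mulRight_antipode {t : H}
    (ht : ∀ h : H, t * h = counit (R := k) h • t) (f : Module.Dual k H) (h : H) :
    dualToSelf t (f ∘ₗ LinearMap.mulRight k (antipode k h)) = dualToSelf t f * h := by
  rw [dualToSelf_apply, dualToSelf_apply, lTensor_comp_mulRight,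
    ← comul_mul_tmul_one_of_right_integral ht, rid_lTensor_mul_tmul_one]

theorem dualToSelf_comp_mulLeft {t : H}
    (ht : ∀ h : H, h * t = counit (R := k) h • t) (f : Module.Dual k H) (h : H) :
    dualToSelf t (f ∘ₗ LinearMap.mulLeft k h) = antipode k h * dualToSelf t f := by
  rw [dualToSelf_apply, dualToSelf_apply, lTensor_comp_mulLeft,
    one_tmul_mul_comul_of_left_integral ht, rid_lTensor_tmul_one_mul]

end Integral

/-! ### The Frobenius functional attached to an integral -/

section Field

variable {k H : Type*} [Field k] [Ring H] [HopfAlgebra k H] [FiniteDimensional k H]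

/-- For a right integral `t`, every `t₁ Φ(t₂)` is of the form `t₁ f(t₂)`. -/
theorem mul'_lTensor_comul_mem_range_dualToSelf {t : H}
    (ht : ∀ h : H, t * h = counit (R := k) h • t) (Φ : H →ₗ[k] H) :
    LinearMap.mul' k H (Φ.lTensor H (comul t)) ∈ LinearMap.range (dualToSelf (k := k) t) := by
  let b := Module.finBasis k H
  -- Expanding `Φ` in a basis leaves right multiples of elements of the range.
  have key : ∀ z : H ⊗[k] H, LinearMap.mul' k H (Φ.lTensor H z) =
      ∑ j, TensorProduct.rid k H ((b.coord j ∘ₗ Φ).lTensor H z) * b j := by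
    intro z
    induction z with
    | zero => simp
    | add p q hp hq => simp only [map_add, add_mul, Finset.sum_add_distrib, hp, hq]
    | tmul x y =>
      conv_lhs => rw [LinearMap.lTensor_tmul, ← b.sum_repr (Φ y)]
      simp only [map_sum, map_smul, TensorProduct.tmul_sum, LinearMap.lTensor_tmul,
        TensorProduct.tmul_smul, LinearMap.mul'_apply, LinearMap.comp_apply,
        TensorProduct.rid_tmul, smul_mul_assoc, Module.Basis.coord_apply]
  rw [key]
  refine Submodule.sum_mem _ fun j _ => ⟨_, dualToSelf_comp_mulRight_antipode ht _ (b j)⟩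

theorem dualToSelf_bijective {t : H} (ht0 : t ≠ 0)
    (ht : ∀ h : H, t * h = counit (R := k) h • t) :
    Function.Bijective (dualToSelf (k := k) t) := by
  have h1 : (1 : H) ∈ LinearMap.range (dualToSelf (k := k) t) := by
    obtain ⟨f, hf⟩ := Module.Projective.exists_dual_eq_one k ht0
    -- With `Φ(y) = S(y₁) f(y₂)`, `t₁ Φ(t₂) = t₁ S(t₂) f(t₃) = f(t) = 1`.
    convert mul'_lTensor_comul_mem_range_dualToSelf ht ((TensorProduct.rid k H).toLinearMap ∘ₗ
      f.lTensor H ∘ₗ (antipode k).rTensor H ∘ₗ comul)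
    have h := congr(TensorProduct.rid k H (f.lTensor H $(sum_mul_antipode_rTensor_comul (k := k) t)))
    simp only [map_sum, rid_lTensor_tmul_one_mul, LinearMap.lTensor_tmul, hf,
      TensorProduct.rid_tmul, one_smul] at h
    rw [← h, ← (ℛ k t).eq]
    simp
  have hs : Function.Surjective (dualToSelf (k := k) t) := by
    obtain ⟨f, hf⟩ := h1
    exact fun h => ⟨_, (dualToSelf_comp_mulRight_antipode ht f h).trans (by rw [hf, one_mul])⟩
  exact ⟨(LinearMap.injective_iff_surjective_of_finrank_eq_finrank
    Subspace.dual_finrank_eq).2 hs, hs⟩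

/-- A unimodular finite-dimensional Hopf algebra has a functional `φ` whose Nakayama automorphism
is the square of the antipode, and dual bases for it. -/
theorem exists_frobenius_functional (hH : IsUnimodular k H) :
    Function.Bijective (antipode k (A := H)) ∧ ∃ (φ : Module.Dual k H),
      (∀ h x : H, φ (h * x) = φ (x * antipode k (antipode k h))) ∧
      ∃ (m : ℕ) (e d : Fin m → H), (∀ x, ∑ i, φ (d i * x) • e i = x) ∧
        (∀ x, ∑ i, φ (x * e i) • d i = x) := by
  obtain ⟨t, ht0, htl, htr⟩ := hH
  have hF := dualToSelf_bijective ht0 htr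
  obtain ⟨φ, hφ⟩ := hF.2 1
  have hr : ∀ h, dualToSelf t (φ ∘ₗ LinearMap.mulRight k (antipode k h)) = h := fun h => by
    rw [dualToSelf_comp_mulRight_antipode htr, hφ, one_mul]
  have hl : ∀ h, dualToSelf t (φ ∘ₗ LinearMap.mulLeft k h) = antipode k h := fun h => by
    rw [dualToSelf_comp_mulLeft htl, hφ, mul_one]
  have hS : Function.Injective (antipode k (A := H)) := by
    rw [injective_iff_map_eq_zero]
    intro h h0
    rw [← hr h, h0]
    simp
  refine ⟨⟨hS, LinearMap.injective_iff_surjective.1 hS⟩, φ, fun h x => ?_, ?_⟩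
  -- `φ(h ·)` and `φ(· S²(h))` both map to `S(h)`.
  · exact LinearMap.congr_fun (hF.1 ((hl h).trans (hr (antipode k h)).symm)) x
  · let b := Module.finBasis k H
    let D : H →ₗ[k] Module.Dual k H := (LinearMap.mul k H).compr₂ φ
    have hD : Function.Injective D := fun x y hxy => hS <| by
      rw [← hl x, ← hl y]
      exact congrArg _ hxy
    obtain ⟨D', hD'⟩ : ∃ D' : H ≃ₗ[k] Module.Dual k H, ∀ x, D' x = D x :=
      ⟨LinearEquiv.ofInjectiveOfFinrankEq D hD Subspace.dual_finrank_eq.symm, fun _ => rfl⟩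
    refine ⟨_, b, fun i => D'.symm (b.coord i), fun x => ?_, fun x => D'.injective ?_⟩
    · have h (i) : φ (D'.symm (b.coord i) * x) = b.coord i x := by
        conv_rhs => rw [← D'.apply_symm_apply (b.coord i), hD']
        rfl
      simp only [h]
      exact b.sum_repr x
    · simp only [map_sum, map_smul, D'.apply_symm_apply]
      rw [hD']
      exact b.sum_dual_apply_smul_coord (D x)

end Field
-- The Frobenius homomorphism for `Δ`
section Expectation

variable {k H : Type*} [CommRing k] [Ring H] [HopfAlgebra k H]

/-- The map `a ⊗ b ↦ φ(a S(b₁)) b₂`. -/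
noncomputable def expectation (φ : Module.Dual k H) : H ⊗[k] H →ₗ[k] H :=
  (TensorProduct.lid k H).toLinearMap ∘ₗ φ.rTensor H ∘ₗ
    TensorProduct.lift (LinearMap.mk₂ k
      (fun a b : H => (a ⊗ₜ[k] (1 : H)) * (antipode k).rTensor H (comul b))
      (fun a a' b => by rw [TensorProduct.add_tmul, add_mul])
      (fun r a b => by rw [← TensorProduct.smul_tmul', smul_mul_assoc])
      (fun a b b' => by simp only [map_add, mul_add])
      (fun r a b => by simp only [map_smul, mul_smul_comm]))

theorem expectation_tmul (φ : Module.Dual k H) (a b : H) :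
    expectation φ (a ⊗ₜ b) = TensorProduct.lid k H
      (φ.rTensor H ((a ⊗ₜ[k] (1 : H)) * (antipode k).rTensor H (comul b))) := rfl

theorem expectation_tmul_eq_sum (φ : Module.Dual k H) (a b : H) :
    expectation φ (a ⊗ₜ b) =
      ∑ j ∈ (ℛ k b).index, φ (a * antipode k ((ℛ k b).left j)) • (ℛ k b).right j := by
  rw [expectation_tmul, ← (ℛ k b).eq]
  simp [Finset.mul_sum]

theorem antipode_rTensor_tmul_mul (u v : H) (z : H ⊗[k] H) :
    (antipode k).rTensor H ((u ⊗ₜ v) * z) =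
      ((1 : H) ⊗ₜ[k] v) * (antipode k).rTensor H z * (antipode k u ⊗ₜ[k] (1 : H)) := by
  induction z with
  | zero => simp
  | add p q hp hq => simp only [mul_add, add_mul, map_add, hp, hq]
  | tmul a b => simp [antipode_mul_antidistrib]

theorem antipode_rTensor_mul_tmul (u v : H) (z : H ⊗[k] H) :
    (antipode k).rTensor H (z * (u ⊗ₜ v)) =
      (antipode k u ⊗ₜ[k] (1 : H)) * (antipode k).rTensor H z * ((1 : H) ⊗ₜ[k] v) := by
  induction z with
  | zero => simp
  | add p q hp hq => simp only [mul_add, add_mul, map_add, hp, hq]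
  | tmul a b => simp [antipode_mul_antidistrib]

/-- `a h₁ S(b₁ h₂) ⊗ b₂ h₃ = a h₁ S(h₂) S(b₁) ⊗ b₂ h₃`, and `h₁ S(h₂)` cancels. -/
theorem expectation_mul_comul (φ : Module.Dual k H) (z : H ⊗[k] H) (h : H) :
    expectation φ (z * comul h) = expectation φ z * h := by
  induction z with
  | zero => simp
  | add p q hp hq => simp only [add_mul, map_add, hp, hq]
  | tmul a b =>
    -- `w` stands for `Δ(b)`; a general tensor permits induction.
    have key (w : H ⊗[k] H) : ∑ i ∈ (ℛ k h).index, ((a * (ℛ k h).left i) ⊗ₜ[k] (1 : H)) *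
        (antipode k).rTensor H (w * comul ((ℛ k h).right i)) =
        ((a ⊗ₜ[k] (1 : H)) * (antipode k).rTensor H w) * (1 ⊗ₜ h) := by
      induction w with
      | zero => simp
      | add p q hp hq => simp only [add_mul, mul_add, map_add, Finset.sum_add_distrib, hp, hq]
      | tmul u v =>
        have e (i) : ((a * (ℛ k h).left i) ⊗ₜ[k] (1 : H)) *
            (antipode k).rTensor H ((u ⊗ₜ v) * comul ((ℛ k h).right i)) =
            (a ⊗ₜ[k] v) * (((ℛ k h).left i ⊗ₜ[k] (1 : H)) *
              (antipode k).rTensor H (comul ((ℛ k h).right i))) *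
              (antipode k u ⊗ₜ[k] (1 : H)) := by
          rw [antipode_rTensor_tmul_mul]
          simp only [← mul_assoc, Algebra.TensorProduct.tmul_mul_tmul, one_mul, mul_one]
        rw [Finset.sum_congr rfl fun i _ => e i, ← Finset.sum_mul, ← Finset.mul_sum,
          sum_mul_antipode_rTensor_comul]
        simp
    have hG (w : H ⊗[k] H) : TensorProduct.lid k H (φ.rTensor H (w * (1 ⊗ₜ h))) =
        TensorProduct.lid k H (φ.rTensor H w) * h := by
      induction w with
      | zero => simp
      | add p q hp hq => simp only [add_mul, map_add, hp, hq]
      | tmul u v => simp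
    rw [expectation_tmul, ← hG, ← key, ← (ℛ k h).eq, Finset.mul_sum]
    simp only [map_sum, Algebra.TensorProduct.tmul_mul_tmul, expectation_tmul,
      Bialgebra.comul_mul]

/-- Moving `h₁` cyclically through `φ` gives `S(h₂) S²(h₁) = S(S(h₁) h₂)`, which cancels. -/
theorem expectation_comul_mul {φ : Module.Dual k H}
    (hφ : ∀ h x : H, φ (h * x) = φ (x * antipode k (antipode k h))) (h : H) (z : H ⊗[k] H) :
    expectation φ (comul h * z) = h * expectation φ z := by
  induction z with
  | zero => simp
  | add p q hp hq => simp only [mul_add, map_add, hp, hq]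
  | tmul a b =>
    have hcyc (x : H) (w : H ⊗[k] H) : φ.rTensor H ((x ⊗ₜ 1) * w) =
        φ.rTensor H (w * (antipode k (antipode k x) ⊗ₜ 1)) := by
      induction w with
      | zero => simp
      | add p q hp hq => simp only [add_mul, mul_add, map_add, hp, hq]
      | tmul u v =>
        simp only [Algebra.TensorProduct.tmul_mul_tmul, LinearMap.rTensor_tmul, one_mul, mul_one,
          hφ x u]
    have key (w : H ⊗[k] H) : ∑ i ∈ (ℛ k h).index, φ.rTensor H (
        (((ℛ k h).left i * a) ⊗ₜ[k] (1 : H)) *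
          (antipode k).rTensor H (comul ((ℛ k h).right i) * w)) =
        φ.rTensor H ((1 ⊗ₜ h) * ((a ⊗ₜ[k] (1 : H)) * (antipode k).rTensor H w)) := by
      induction w with
      | zero => simp
      | add p q hp hq => simp only [mul_add, map_add, Finset.sum_add_distrib, hp, hq]
      | tmul u v =>
        have e (i) : φ.rTensor H ((((ℛ k h).left i * a) ⊗ₜ[k] (1 : H)) *
            (antipode k).rTensor H (comul ((ℛ k h).right i) * (u ⊗ₜ v))) =
            φ.rTensor H (((a * antipode k u) ⊗ₜ[k] (1 : H)) * (antipode k).rTensor H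
              ((antipode k ((ℛ k h).left i) ⊗ₜ[k] (1 : H)) * comul ((ℛ k h).right i)) *
                (1 ⊗ₜ v)) := by
          have e1 : (((ℛ k h).left i * a) ⊗ₜ[k] (1 : H)) =
            ((ℛ k h).left i ⊗ₜ[k] (1 : H)) * (a ⊗ₜ 1) := by simp
          rw [e1, mul_assoc, hcyc, antipode_rTensor_mul_tmul, antipode_rTensor_tmul_mul]
          simp only [mul_assoc, Algebra.TensorProduct.tmul_mul_tmul, one_mul, mul_one,
            ← Algebra.TensorProduct.one_def]
          simp only [← mul_assoc, Algebra.TensorProduct.tmul_mul_tmul, mul_one]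
        rw [Finset.sum_congr rfl fun i _ => e i, ← map_sum, ← Finset.sum_mul, ← Finset.mul_sum,
          ← map_sum, sum_antipode_tmul_one_mul_comul]
        simp
    have hG (w : H ⊗[k] H) : TensorProduct.lid k H (φ.rTensor H ((1 ⊗ₜ h) * w)) =
        h * TensorProduct.lid k H (φ.rTensor H w) := by
      induction w with
      | zero => simp
      | add p q hp hq => simp only [mul_add, map_add, hp, hq]
      | tmul u v => simp
    rw [expectation_tmul, ← hG, ← key, ← (ℛ k h).eq, Finset.sum_mul]
    simp only [map_sum, Algebra.TensorProduct.tmul_mul_tmul, expectation_tmul,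
      Bialgebra.comul_mul]

/-- Summing over the dual bases leaves `a S(b₁) b₂ ⊗ b₃ = a ⊗ b`. -/
theorem sum_mul_comul_expectation {φ : Module.Dual k H} {ι : Type*} [Fintype ι] {e d : ι → H}
    (hed : ∀ x, ∑ i, φ (d i * x) • e i = x) (z : H ⊗[k] H) :
    ∑ i, (e i ⊗ₜ[k] (1 : H)) * comul (expectation φ ((d i ⊗ₜ[k] (1 : H)) * z)) = z := by
  induction z with
  | zero => simp
  | add p q hp hq => simp only [mul_add, map_add, Finset.sum_add_distrib, hp, hq]
  | tmul a b =>
    simp only [Algebra.TensorProduct.tmul_mul_tmul, one_mul, expectation_tmul_eq_sum, map_sum,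
      map_smul, Finset.mul_sum, mul_smul_comm, ← smul_mul_assoc, TensorProduct.smul_tmul']
    rw [Finset.sum_comm]
    simp only [← Finset.sum_mul, ← TensorProduct.sum_tmul, mul_assoc, hed]
    have h := congr((a ⊗ₜ[k] (1 : H)) * $(sum_antipode_tmul_one_mul_comul (k := k) b))
    simpa only [Finset.mul_sum, ← mul_assoc, Algebra.TensorProduct.tmul_mul_tmul, one_mul,
      mul_one] using h

/-- With `σ = S⁻¹`, `φ(x S(y)) = φ(σ(y) x)` brings `e i` to the right end; the sum becomes `b₂ σ(b₁)
a ⊗ b₃ = a ⊗ b`. -/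
theorem sum_comul_expectation_mul {φ : Module.Dual k H} {ι : Type*} [Fintype ι] {e d : ι → H}
    (hφ : ∀ h x : H, φ (h * x) = φ (x * antipode k (antipode k h)))
    (hS : Function.Bijective (antipode k (A := H)))
    (hed : ∀ x, ∑ i, φ (x * e i) • d i = x) (z : H ⊗[k] H) :
    ∑ i, comul (expectation φ (z * (e i ⊗ₜ[k] (1 : H)))) * (d i ⊗ₜ[k] (1 : H)) = z := by
  obtain ⟨σ, hσ⟩ : ∃ σ : H →ₗ[k] H, ∀ h, antipode k (σ h) = h :=
    ⟨(LinearEquiv.ofBijective _ hS).symm, (LinearEquiv.ofBijective _ hS).apply_symm_apply⟩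
  induction z with
  | zero => simp
  | add p q hp hq => simp only [add_mul, map_add, Finset.sum_add_distrib, hp, hq]
  | tmul a b =>
    have hc (x y : H) : φ (x * antipode k y) = φ (σ y * x) := by rw [hφ (σ y), hσ]
    simp only [Algebra.TensorProduct.tmul_mul_tmul, mul_one, expectation_tmul_eq_sum, map_sum,
      map_smul, Finset.sum_mul, smul_mul_assoc, ← mul_smul_comm, TensorProduct.smul_tmul', hc]
    rw [Finset.sum_comm]
    simp only [← Finset.mul_sum, ← TensorProduct.sum_tmul, ← mul_assoc, hed]
    have h := congr($(sum_comul_mul_antipode_inv_tmul_one hσ hS.1 b) * (a ⊗ₜ[k] (1 : H)))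
    simpa only [Finset.sum_mul, mul_assoc, Algebra.TensorProduct.tmul_mul_tmul, one_mul,
      mul_one] using h

end Expectation

/-- The comultiplication of a unimodular finite-dimensional Hopf algebra is a Frobenius
extension. -/
theorem comulAlgHom_isFrobeniusExtension {k H : Type*} [Field k] [Ring H] [HopfAlgebra k H]
    [FiniteDimensional k H] (hH : IsUnimodular k H) :
    IsFrobeniusExtension (Bialgebra.comulAlgHom k H : H →+* H ⊗[k] H) := by
  obtain ⟨hS, φ, hφ, m, e, d, hed, hde⟩ := exists_frobenius_functional hH
  exact ⟨(expectation φ).toAddMonoidHom, m, fun i => e i ⊗ₜ 1, fun i => d i ⊗ₜ 1,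
    expectation_comul_mul hφ, expectation_mul_comul φ, sum_mul_comul_expectation hed,
    sum_comul_expectation_mul hφ hS hde⟩

end HopfAlgebra

theorem mainTheorem5 (k H : Type*) [Field k] [Ring H] [HopfAlgebra k H] [FiniteDimensional k H]
    (hH : IsUnimodular k H) (n : ℕ) :
    Function.Injective (iterComul k H n) ∧
      IsFrobeniusExtension (iterComul k H n : H →+* (⨂[k] _ : Fin (n + 1), H)) :=
  ⟨iterComul_injective k H n,
    iterComul_isFrobeniusExtension k H (HopfAlgebra.comulAlgHom_isFrobeniusExtension hH) n⟩
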